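/- Let $\mathcal H_M$ and $\mathcal H_S$ be finite-dimensional complex Hilbert spaces, let $\{|W_j\rangle\}_{j\in J}$ be a finite orthonormal family in $\mathcal H_M$ and let $X=\{X_j\}_{j\in J}$ be a projection valued measure on $\mathcal H_S$ (mutually orthogonal projectors, of arbitrary rank, with $\sum_j X_j=\mathbb 1$). Put $V_X=\sum_j |W_j\rangle\otimes X_j$, let $\rho_S$ be a density operator on $\mathcal H_S$, and let $\tilde\rho=V_X\rho_S V_X^\dagger$ be the corresponding premeasurement state on $\mathcal H_M\otimes\mathcal H_S$. For positive semidefinite $P,Q$ with $Q\neq 0$ put $F(P,Q)=\mathrm{Tr}\,(\sqrt P\,Q\sqrt P)^{1/2}$, $$D_{\max}(P\|Q)=\log\min\{\lambda: P\le\lambda Q\},\qquad D_{\mathrm{fid}}(P\|Q)=-2\log F(P,Q),$$ with values in $[-\infty,\infty]$ (where $\min\emptyset=\infty$, $\log 0=-\infty$, $\log\infty=\infty$). For $D\in\{D_{\max},D_{\mathrm{fid}}\}$ and a positive semidefinite operator $\sigma$ on $\mathcal H_M\otimes\mathcal H_S$ define $$H_D(M|S)_\sigma=\sup_{\tau}\,[-D(\sigma\|\mathbb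 1\otimes\tau)]\quad(\tau\text{ a density operator on }\mathcal H_S),$$ and, for a class $\mathsf C$ of density operators on $\mathcal H_M\otimes\mathcal H_S$, $D(\sigma\|\mathsf C)=\inf_{\tau\in\mathsf C}D(\sigma\|\tau)$. Let $\mathsf{Sep}$ be the set of separable states $\sum_j p_j\,\rho_{M,j}\otimes\rho_{S,j}$; $\mathsf{CQ}$ the set of states $\sum_j p_j|e_j\rangle\langle e_j|\otimes\rho_{S,j}$; $\mathsf{QC}$ the set of states $\sum_k p_k\,\rho_{M,k}\otimes|f_k\rangle\langle f_k|$; and $\mathsf{CC}$ the set of states $\sum_{j,k}p_{j,k}|e_j\rangle\langle e_j|\otimes|f_k\rangle\langle f_k|$. Here $p$ is a probability distribution, the $\rho_{M,j}$ and $\rho_{S,j}$ are density operators, and $\{e_j\}$, $\{f_k\}$ are arbitrary orthonormal bases of $\mathcal H_M$, $\mathcal H_S$. The quantity $D(\sigma\|\mathsf{Sep})$ is the entanglement of $\sigma$, $D(\sigma\|\mathsf{CQ})$ and $D(\sigma\|\mathsf{QC})$ are its one-way discords, and $D(\sigma\|\mathsf{CC})$ is its two-way discord, based on $D$. For $\varepsilon\ge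 0$ let $\mathcal B^\varepsilon(\tilde\rho)$ be the set of all positive semidefinite $\sigma$ on $\mathcal H_M\otimes\mathcal H_S$ with $\mathrm{Tr}\,\sigma\le1$ and purified distance $P(\tilde\rho,\sigma)\le\varepsilon$, where $P(\rho,\sigma)=\sqrt{1-\overline F(\rho,\sigma)^2}$ and $\overline F(\rho,\sigma)=F(\rho,\sigma)+\sqrt{(1-\mathrm{Tr}\rho)(1-\mathrm{Tr}\sigma)}$. Let $$H^\varepsilon_{\min}(M|S)_{\tilde\rho}=\sup_{\sigma\in\mathcal B^\varepsilon(\tilde\rho)}H_{D_{\max}}(M|S)_\sigma,\qquad H^\varepsilon_{\max}(M|S)_{\tilde\rho}=\inf_{\sigma\in\mathcal B^\varepsilon(\tilde\rho)}H_{D_{\mathrm{fid}}}(M|S)_\sigma .$$ Then, for every $\varepsilon\ge0$, with $\mathcal B=\mathcal B^\varepsilon(\tilde\rho)$, $$-H^\varepsilon_{\min}(M|S)_{\tilde\rho}=\inf_{\sigma\in\mathcal B}D_{\max}(\sigma\|\mathsf{Sep})=\inf_{\sigma\in\mathcal B}D_{\max}(\sigma\|\mathsf{CQ})=\inf_{\sigma\in\mathcal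 B}D_{\max}(\sigma\|\mathsf{QC})=\inf_{\sigma\in\mathcal B}D_{\max}(\sigma\|\mathsf{CC}),$$ $$-H^\varepsilon_{\max}(M|S)_{\tilde\rho}=\sup_{\sigma\in\mathcal B}D_{\mathrm{fid}}(\sigma\|\mathsf{Sep})=\sup_{\sigma\in\mathcal B}D_{\mathrm{fid}}(\sigma\|\mathsf{CQ})=\sup_{\sigma\in\mathcal B}D_{\mathrm{fid}}(\sigma\|\mathsf{QC})=\sup_{\sigma\in\mathcal B}D_{\mathrm{fid}}(\sigma\|\mathsf{CC}).$$ -/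

import Mathlib

open scoped MatrixOrder ComplexOrder Kronecker NNReal ENNReal

noncomputable section

namespace SmoothCollapse

/-! Operators on the Hilbert space `ℂ^n` with a finite index type `n` are matrices
`Matrix n n ℂ`; the tensor product of `ℂ^a` and `ℂ^b` is `ℂ^(a × b)`, and tensor products of
operators are Kronecker products. The order on matrices is the Loewner order. -/

variable {n a b J : Type*} [Fintype n] [DecidableEq n] [Fintype a] [DecidableEq a]
  [Fintype b] [DecidableEq b] [Fintype J]

/-- Normalized density operators: positive semidefinite with trace one. -/
def Density (n : Type*) [Fintype n] : Set (Matrix n n ℂ) :=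
  {ρ | ρ.PosSemidef ∧ ρ.trace = 1}

/-- Subnormalized states: positive semidefinite with trace at most one. -/
def SubDensity (n : Type*) [Fintype n] : Set (Matrix n n ℂ) :=
  {ρ | ρ.PosSemidef ∧ ρ.trace.re ≤ 1}

/-- The rank-one operator `|v⟩⟨v|`. -/
def ketBra (v : EuclideanSpace ℂ n) : Matrix n n ℂ :=
  Matrix.vecMulVec v.ofLp (star v.ofLp)

/-! ### Premeasurement states -/

/-- A projection valued measure with finitely many outcomes: orthogonal projectors (not
necessarily of rank one, possibly zero), mutually orthogonal, with sum the identity. -/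
structure IsPVM (X : J → Matrix b b ℂ) : Prop where
  isHermitian : ∀ j, (X j).IsHermitian
  idem : ∀ j, X j * X j = X j
  orthogonal : ∀ j k, j ≠ k → X j * X k = 0
  sum_eq_one : ∑ j, X j = 1

/-- The operator `V_X = ∑ j, |W j⟩ ⊗ X j` from `ℂ^b` to `ℂ^a ⊗ ℂ^b`. -/
def premeasurementIsometry (W : J → EuclideanSpace ℂ a) (X : J → Matrix b b ℂ) :
    Matrix (a × b) b ℂ :=
  Matrix.of fun i t => ∑ j, W j i.1 * X j i.2 t

/-- The premeasurement state `V_X ρ V_X†`. -/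
def premeasurementState (W : J → EuclideanSpace ℂ a) (X : J → Matrix b b ℂ)
    (ρ : Matrix b b ℂ) : Matrix (a × b) (a × b) ℂ :=
  premeasurementIsometry W X * ρ * (premeasurementIsometry W X).conjTranspose

/-! ### Classes of bipartite states -/

/-- Separable states `∑ j, p j • ρA j ⊗ ρB j`. -/
def Sep (a b : Type*) [Fintype a] [Fintype b] : Set (Matrix (a × b) (a × b) ℂ) :=
  {ρ | ∃ (m : ℕ) (p : Fin m → ℝ) (ρA : Fin m → Matrix a a ℂ) (ρB : Fin m → Matrix b b ℂ),
    (∀ j, 0 ≤ p j) ∧ ∑ j, p j = 1 ∧ (∀ j, ρA j ∈ Density a) ∧ (∀ j, ρB j ∈ Density b) ∧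
    ρ = ∑ j, (p j : ℂ) • (ρA j ⊗ₖ ρB j)}

/-- Classical-quantum states `∑ j, p j • |e j⟩⟨e j| ⊗ ρB j`, with `e` an orthonormal basis of
the first system. -/
def CQ (a b : Type*) [Fintype a] [Fintype b] : Set (Matrix (a × b) (a × b) ℂ) :=
  {ρ | ∃ (e : OrthonormalBasis a ℂ (EuclideanSpace ℂ a)) (p : a → ℝ) (ρB : a → Matrix b b ℂ),
    (∀ j, 0 ≤ p j) ∧ ∑ j, p j = 1 ∧ (∀ j, ρB j ∈ Density b) ∧
    ρ = ∑ j, (p j : ℂ) • (ketBra (e j) ⊗ₖ ρB j)}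

/-- Quantum-classical states: classical with respect to the second system. -/
def QC (a b : Type*) [Fintype a] [Fintype b] : Set (Matrix (a × b) (a × b) ℂ) :=
  {ρ | ∃ (f : OrthonormalBasis b ℂ (EuclideanSpace ℂ b)) (p : b → ℝ) (ρA : b → Matrix a a ℂ),
    (∀ k, 0 ≤ p k) ∧ ∑ k, p k = 1 ∧ (∀ k, ρA k ∈ Density a) ∧
    ρ = ∑ k, (p k : ℂ) • (ρA k ⊗ₖ ketBra (f k))}

/-- Classical-classical states. -/
def CC (a b : Type*) [Fintype a] [Fintype b] : Set (Matrix (a × b) (a × b) ℂ) :=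
  {ρ | ∃ (e : OrthonormalBasis a ℂ (EuclideanSpace ℂ a))
      (f : OrthonormalBasis b ℂ (EuclideanSpace ℂ b)) (p : a → b → ℝ),
    (∀ j k, 0 ≤ p j k) ∧ ∑ j, ∑ k, p j k = 1 ∧
    ρ = ∑ j, ∑ k, (p j k : ℂ) • (ketBra (e j) ⊗ₖ ketBra (f k))}

/-! ### Relative entropies, with values in the extended reals -/

/-- The fidelity `Tr (√P Q √P)^{1/2}`. -/
def fidelity (P Q : Matrix n n ℂ) : ℝ :=
  (CFC.sqrt (CFC.sqrt P * Q * CFC.sqrt P)).trace.re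

/-- `D_max(P‖Q) = log min {r : P ≤ r Q}`, for positive semidefinite `P` and `Q`, where `Q ≠ 0`;
it is `⊤` if there is no such `r`, and `⊥` if `P = 0`. -/
def Dmax (P Q : Matrix n n ℂ) : EReal :=
  ENNReal.log (⨅ (r : ℝ≥0) (_ : P ≤ (r : ℝ) • Q), (r : ℝ≥0∞))

/-- `D_fid(P‖Q) = -2 log Tr (√P Q √P)^{1/2}`; it is `⊤` if the fidelity is zero. -/
def Dfid (P Q : Matrix n n ℂ) : EReal :=
  -(2 * ENNReal.log (ENNReal.ofReal (fidelity P Q)))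

/-! ### Purified distance and balls -/

/-- The generalized fidelity of subnormalized states. -/
def genFidelity (ρ σ : Matrix n n ℂ) : ℝ :=
  fidelity ρ σ + Real.sqrt ((1 - ρ.trace.re) * (1 - σ.trace.re))

/-- The purified distance of subnormalized states. -/
def purifiedDist (ρ σ : Matrix n n ℂ) : ℝ :=
  Real.sqrt (1 - genFidelity ρ σ ^ 2)

/-- The ball of radius `ε` around `ρ`, in the set of subnormalized states. -/
def ball (ε : ℝ) (ρ : Matrix n n ℂ) : Set (Matrix n n ℂ) :=
  {σ | σ ∈ SubDensity n ∧ purifiedDist ρ σ ≤ ε}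

/-! ### Conditional entropy, entanglement and discord for a relative entropy `D` -/

section Measures

variable (D : Matrix (a × b) (a × b) ℂ → Matrix (a × b) (a × b) ℂ → EReal)
  (ρ : Matrix (a × b) (a × b) ℂ)

/-- The conditional entropy of the first system given the second. -/
def condEntropy : EReal := ⨆ τ ∈ Density b, -D ρ ((1 : Matrix a a ℂ) ⊗ₖ τ)

/-- The entanglement measure. -/
def entanglement : EReal := ⨅ τ ∈ Sep a b, D ρ τ

/-- The one-way discord, classical on the first system. -/
def discordCQ : EReal := ⨅ τ ∈ CQ a b, D ρ τ

/-- The one-way discord, classical on the second system. -/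
def discordQC : EReal := ⨅ τ ∈ QC a b, D ρ τ

/-- The two-way discord. -/
def discordCC : EReal := ⨅ τ ∈ CC a b, D ρ τ

end Measures

/-! ### Smoothing -/

/-- Minimization of a measure over the ball. -/
def smoothInf (f : Matrix n n ℂ → EReal) (ε : ℝ) (ρ : Matrix n n ℂ) : EReal :=
  ⨅ σ ∈ ball ε ρ, f σ

/-- Maximization of a measure over the ball. -/
def smoothSup (f : Matrix n n ℂ → EReal) (ε : ℝ) (ρ : Matrix n n ℂ) : EReal :=
  ⨆ σ ∈ ball ε ρ, f σ

/-- The smooth min-entropy of the first system given the second. -/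
def smoothHmin (ε : ℝ) (ρ : Matrix (a × b) (a × b) ℂ) : EReal :=
  smoothSup (condEntropy Dmax) ε ρ

/-- The smooth max-entropy of the first system given the second. -/
def smoothHmax (ε : ℝ) (ρ : Matrix (a × b) (a × b) ℂ) : EReal :=
  smoothInf (condEntropy Dfid) ε ρ

end SmoothCollapse

end

/-!
The range of `V = V_X` is the range of the projection `K = V V† = ∑ j, |W j⟩⟨W j| ⊗ X j`, and
`K ρ K = ρ`. Two facts about `K` give the result. It maps `1 ⊗ τ` to the classical-classical state
`∑ j, |W j⟩⟨W j| ⊗ X j τ X j` (`conj_one_kronecker_mem_CC`; the operators `X j τ X j` have pairwise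
product zero, so they are diagonal in a common basis). And `σ ↦ K σ K` maps the ball around `ρ` to
itself (`conj_mem_ball`): the trace does not grow, and `F(ρ, K σ K) = F(K ρ K, σ) = F(ρ, σ)`.

For each single `σ`, a separable state lies below `1 ⊗ τ_S` with `τ_S` its reduced state, and `D` is
antitone in its second argument, so
`-H_D(M|S)_σ ≤ D(σ‖Sep) ≤ D(σ‖CQ), D(σ‖QC) ≤ D(σ‖CC)`.
After optimization over the ball the chain closes:
* for `D_max`, the pair `K σ K`, `K (1 ⊗ τ) K` is at most as far apart as `σ`, `1 ⊗ τ`, and its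
  second member is classical-classical (`Dmax_conj_le`);
* for `D_fid`, the entropy of `K σ K` is bounded by the two-way discord of `σ`, because
  `F(K σ K, 1 ⊗ τ) = F(σ, K (1 ⊗ τ) K)` (`fidelity_conj`).
-/

noncomputable section

namespace SmoothCollapse

open Matrix

variable {n a b : Type*} [Fintype n] [Fintype a] [Fintype b]

/-! ### Square roots and the fidelity -/

section
open scoped Matrix.Norms.L2Operator

/-- Operator monotonicity of the square root. The L2 operator norm serves only to make matrices a
C⋆-algebra; the statement does not depend on it. -/
lemma sqrt_mono [DecidableEq n] {P Q : Matrix n n ℂ} (h : P ≤ Q) : CFC.sqrt P ≤ CFC.sqrt Q :=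
  CFC.sqrt_le_sqrt P Q h

end

lemma trace_re_mono {P Q : Matrix n n ℂ} (h : P ≤ Q) : P.trace.re ≤ Q.trace.re := by
  have := (Complex.le_def.1 (Matrix.le_iff.1 h).trace_nonneg).1
  simp only [trace_sub, Complex.sub_re, Complex.zero_re] at this
  linarith

lemma mul_mul_mono {P Q A : Matrix n n ℂ} (hA : A.IsHermitian) (h : P ≤ Q) :
    A * P * A ≤ A * Q * A := by
  rw [Matrix.le_iff] at *
  have := h.mul_mul_conjTranspose_same A
  rwa [hA.eq, mul_sub, sub_mul] at this

lemma sqrt_isHermitian [DecidableEq n] (P : Matrix n n ℂ) : (CFC.sqrt P).IsHermitian :=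
  (Matrix.nonneg_iff_posSemidef.1 (CFC.sqrt_nonneg P)).isHermitian

lemma fidelity_mono [DecidableEq n]
    {P Q Q' : Matrix n n ℂ} (h : Q ≤ Q') : fidelity P Q ≤ fidelity P Q' :=
  trace_re_mono (sqrt_mono (mul_mul_mono (sqrt_isHermitian P) h))

/-- `Tr |A†| = Tr |A|`: the matrices `A A†` and `A† A` have the same characteristic polynomial,
hence the same eigenvalues. -/
lemma trace_sqrt_mul_conjTranspose [DecidableEq n] (A : Matrix n n ℂ) :
    (CFC.sqrt (A * Aᴴ)).trace = (CFC.sqrt (Aᴴ * A)).trace := by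
  have h1 := isHermitian_mul_conjTranspose_self A
  have h2 := isHermitian_conjTranspose_mul_self A
  rw [CFC.sqrt_eq_real_sqrt _ (nonneg_iff_posSemidef.2 (posSemidef_self_mul_conjTranspose A)),
    CFC.sqrt_eq_real_sqrt _ (nonneg_iff_posSemidef.2 (posSemidef_conjTranspose_mul_self A)),
    cfcₙ_eq_cfc, cfcₙ_eq_cfc, trace_eq_neg_charpoly_nextCoeff, trace_eq_neg_charpoly_nextCoeff,
    h1.charpoly_cfc_eq, h2.charpoly_cfc_eq,
    (h1.eigenvalues_eq_eigenvalues_iff h2).2 (charpoly_mul_comm _ _)]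

/-- Both sides are the trace norm of `√P K √Q`. -/
lemma trace_sqrt_conj [DecidableEq n]
    {K P Q : Matrix n n ℂ} (hK : K.IsHermitian) (hP : P.PosSemidef)
    (hQ : Q.PosSemidef) :
    (CFC.sqrt (CFC.sqrt P * (K * Q * K) * CFC.sqrt P)).trace =
      (CFC.sqrt (CFC.sqrt Q * (K * P * K) * CFC.sqrt Q)).trace := by
  have h := trace_sqrt_mul_conjTranspose (CFC.sqrt P * K * CFC.sqrt Q)
  simp only [conjTranspose_mul, (sqrt_isHermitian _).eq, hK.eq] at h
  convert h using 3
  · conv_lhs => rw [← CFC.sqrt_mul_sqrt_self Q (Matrix.nonneg_iff_posSemidef.2 hQ)]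
    simp only [Matrix.mul_assoc]
  · conv_lhs => rw [← CFC.sqrt_mul_sqrt_self P (Matrix.nonneg_iff_posSemidef.2 hP)]
    simp only [Matrix.mul_assoc]

lemma fidelity_comm [DecidableEq n] {P Q : Matrix n n ℂ} (hP : P.PosSemidef) (hQ : Q.PosSemidef) :
    fidelity P Q = fidelity Q P := by
  simpa [fidelity] using congrArg Complex.re (trace_sqrt_conj isHermitian_one hP hQ)

/-- A Hermitian operator may be moved from one argument of the fidelity to the other. -/
lemma fidelity_conj [DecidableEq n] {K P Q : Matrix n n ℂ} (hK : K.IsHermitian) (hP : P.PosSemidef)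
    (hQ : Q.PosSemidef) : fidelity (K * P * K) Q = fidelity P (K * Q * K) := by
  have hR : (K * P * K).PosSemidef := by simpa [hK.eq] using hP.mul_mul_conjTranspose_same K
  rw [fidelity_comm hR hQ]
  exact congrArg Complex.re (trace_sqrt_conj hK hP hQ).symm

/-! ### Density operators -/

lemma Density.le_one [DecidableEq n] {A : Matrix n n ℂ} (hA : A ∈ Density n) : A ≤ 1 := by
  have h := hA.1.isHermitian
  have key : A ≤ algebraMap ℝ (Matrix n n ℂ) 1 := by
    refine le_algebraMap_of_spectrum_le (fun x hx => ?_) h.isSelfAdjoint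
    rw [h.spectrum_real_eq_range_eigenvalues] at hx
    obtain ⟨i, rfl⟩ := hx
    have htr := h.trace_eq_sum_eigenvalues
    rw [hA.2] at htr
    have htr' : ∑ i, h.eigenvalues i = 1 := by
      simpa using (congrArg Complex.re htr).symm
    -- an eigenvalue is at most the sum of all of them, which is the trace
    rw [← htr']
    exact Finset.single_le_sum (fun j _ => hA.1.eigenvalues_nonneg j) (Finset.mem_univ i)
  simpa using key

/-- Every positive semidefinite matrix, including `0`, is its trace times a density operator. -/
lemma exists_density_smul_eq [Nonempty n] {A : Matrix n n ℂ} (hA : A.PosSemidef) :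
    ∃ ρ ∈ Density n, A = (A.trace.re : ℂ) • ρ := by
  classical
  have h0 := hA.trace_nonneg
  have htr : (A.trace.re : ℂ) = A.trace := (Complex.eq_re_of_ofReal_le h0).symm
  by_cases hz : A.trace = 0
  · obtain ⟨i⟩ := ‹Nonempty n›
    refine ⟨Matrix.single i i 1, ⟨?_, by simp⟩, ?_⟩
    · rw [← diagonal_single]
      refine PosSemidef.diagonal fun j => ?_
      by_cases h : j = i <;> simp [h]
    · rw [hz, hA.trace_eq_zero_iff.1 hz]; simp
  · refine ⟨(A.trace)⁻¹ • A, ⟨hA.smul (inv_nonneg.2 h0), ?_⟩, ?_⟩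
    · rw [trace_smul, smul_eq_mul, inv_mul_cancel₀ hz]
    · rw [htr, smul_smul, mul_inv_cancel₀ hz, one_smul]

lemma trace_ketBra (v : EuclideanSpace ℂ n) (hv : ‖v‖ = 1) : (ketBra v).trace = 1 := by
  have := inner_self_eq_norm_sq_to_K (𝕜 := ℂ) v
  rw [hv] at this
  rw [ketBra, trace_vecMulVec, ← EuclideanSpace.inner_eq_star_dotProduct]
  simpa using this

lemma ketBra_posSemidef (v : EuclideanSpace ℂ n) : (ketBra v).PosSemidef :=
  posSemidef_vecMulVec_self_star _

lemma ketBra_mem_density (v : EuclideanSpace ℂ n) (hv : ‖v‖ = 1) : ketBra v ∈ Density n :=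
  ⟨ketBra_posSemidef v, trace_ketBra v hv⟩

/-! ### Inclusions between the classes of states -/

/-- Convex combinations of product states over an arbitrary finite index type are separable. -/
lemma mem_sep {ι : Type*} [Fintype ι] {p : ι → ℝ} {A : ι → Matrix a a ℂ} {B : ι → Matrix b b ℂ}
    (hp : ∀ j, 0 ≤ p j) (h1 : ∑ j, p j = 1) (hA : ∀ j, A j ∈ Density a)
    (hB : ∀ j, B j ∈ Density b) : ∑ j, (p j : ℂ) • (A j ⊗ₖ B j) ∈ Sep a b := by
  let g := (Fintype.equivFin ι).symm
  exact ⟨Fintype.card ι, p ∘ g, A ∘ g, B ∘ g, fun _ => hp _, (g.sum_comp p).trans h1,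
    fun _ => hA _, fun _ => hB _, (g.sum_comp fun j => (p j : ℂ) • (A j ⊗ₖ B j)).symm⟩

lemma CQ_subset_Sep : CQ a b ⊆ Sep a b := by
  rintro _ ⟨e, p, B, hp, h1, hB, rfl⟩
  exact mem_sep hp h1 (fun j => ketBra_mem_density _ (e.orthonormal.1 j)) hB

lemma QC_subset_Sep : QC a b ⊆ Sep a b := by
  rintro _ ⟨f, p, A, hp, h1, hA, rfl⟩
  exact mem_sep hp h1 hA (fun j => ketBra_mem_density _ (f.orthonormal.1 j))

lemma exists_density_smul_eq_sum [Nonempty n] (f : OrthonormalBasis n ℂ (EuclideanSpace ℂ n))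
    {p : n → ℝ} (hp : ∀ k, 0 ≤ p k) :
    ∃ ρ ∈ Density n, ∑ k, (p k : ℂ) • ketBra (f k) = ((∑ k, p k : ℝ) : ℂ) • ρ := by
  have hA : (∑ k, (p k : ℂ) • ketBra (f k)).PosSemidef :=
    posSemidef_sum _ fun k _ => (ketBra_posSemidef _).smul (by exact_mod_cast hp k)
  obtain ⟨ρ, hρ, h⟩ := exists_density_smul_eq hA
  refine ⟨ρ, hρ, h.trans ?_⟩
  simp [trace_sum, trace_smul, trace_ketBra _ (f.orthonormal.1 _)]

lemma kronecker_sum_smul {k l ι : Type*} (s : Finset ι) (A : Matrix k k ℂ) (c : ι → ℂ)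
    (B : ι → Matrix l l ℂ) : A ⊗ₖ (∑ k ∈ s, c k • B k) = ∑ k ∈ s, c k • (A ⊗ₖ B k) := by
  ext ⟨i, s⟩ ⟨j, t⟩
  simp [Matrix.sum_apply, Finset.mul_sum, mul_left_comm]

lemma sum_smul_kronecker {k l ι : Type*} (s : Finset ι) (A : ι → Matrix k k ℂ) (c : ι → ℂ)
    (B : Matrix l l ℂ) : (∑ k ∈ s, c k • A k) ⊗ₖ B = ∑ k ∈ s, c k • (A k ⊗ₖ B) := by
  ext ⟨i, s⟩ ⟨j, t⟩
  simp [Matrix.sum_apply, Finset.sum_mul, mul_assoc]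

lemma CC_subset_CQ : CC a b ⊆ CQ a b := by
  rintro _ ⟨e, f, p, hp, h1, rfl⟩
  cases isEmpty_or_nonempty b
  · simp at h1
  choose B hB h using fun j => exists_density_smul_eq_sum f (hp j)
  refine ⟨e, fun j => ∑ k, p j k, B, fun j => Finset.sum_nonneg fun k _ => hp j k, h1, hB, ?_⟩
  refine Finset.sum_congr rfl fun j _ => ?_
  rw [← kronecker_sum_smul, h, kronecker_smul]

lemma CC_subset_QC : CC a b ⊆ QC a b := by
  rintro _ ⟨e, f, p, hp, h1, rfl⟩
  cases isEmpty_or_nonempty a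
  · simp at h1
  choose A hA h using fun k => exists_density_smul_eq_sum e (fun j => hp j k)
  refine ⟨f, fun k => ∑ j, p j k, A, fun k => Finset.sum_nonneg fun j _ => hp j k,
    Finset.sum_comm.trans h1, hA, ?_⟩
  rw [Finset.sum_comm]
  refine Finset.sum_congr rfl fun k _ => ?_
  rw [← sum_smul_kronecker, h, smul_kronecker]

/-- A separable state `τ` satisfies `τ ≤ 1 ⊗ τ_B`, where `τ_B` is its reduced state on the second
system. -/
lemma exists_density_one_kronecker_ge [DecidableEq a]
    {τ : Matrix (a × b) (a × b) ℂ} (hτ : τ ∈ Sep a b) :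
    ∃ ω ∈ Density b, τ ≤ (1 : Matrix a a ℂ) ⊗ₖ ω := by
  obtain ⟨m, p, A, B, hp, h1, hA, hB, rfl⟩ := hτ
  refine ⟨∑ j, (p j : ℂ) • B j, ⟨posSemidef_sum _ fun j _ => (hB j).1.smul
    (by exact_mod_cast hp j), ?_⟩, ?_⟩
  · simp only [trace_sum, trace_smul, (hB _).2, smul_eq_mul, mul_one]
    exact_mod_cast h1
  · rw [kronecker_sum_smul, Matrix.le_iff, ← Finset.sum_sub_distrib]
    -- each summand obeys `A j ⊗ B j ≤ 1 ⊗ B j`, as `A j ≤ 1`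
    refine posSemidef_sum _ fun j _ => ?_
    rw [← smul_sub]
    have : (1 : Matrix a a ℂ) ⊗ₖ B j - A j ⊗ₖ B j = (1 - A j) ⊗ₖ B j := by
      ext ⟨i, s⟩ ⟨k, t⟩; simp [sub_mul]
    rw [this]
    exact ((Matrix.le_iff.1 (Density.le_one (hA j))).kronecker (hB j).1).smul
      (by exact_mod_cast hp j)

/-! ### Joint diagonalization and classical-classical states -/

/-- Commuting Hermitian matrices have a common orthonormal eigenbasis. -/
lemma exists_orthonormalBasis_mulVec [DecidableEq n] {ι : Type*} [Fintype ι] {Y : ι → Matrix n n ℂ}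
    (hY : ∀ i, (Y i).IsHermitian) (hC : Pairwise fun i j => Commute (Y i) (Y j)) :
    ∃ (f : OrthonormalBasis n ℂ (EuclideanSpace ℂ n)) (c : ι → n → ℂ),
      ∀ i k, toEuclideanLin (Y i) (f k) = c i k • f k := by
  classical
  have hS : ∀ i, (toEuclideanLin (Y i)).IsSymmetric := fun i =>
    isSymmetric_toEuclideanLin_iff.2 (hY i)
  have hC' : Pairwise (Function.onFun Commute fun i => toEuclideanLin (Y i)) := fun i j h => by
    simpa only [Function.onFun, Commute, SemiconjBy, Module.End.mul_eq_comp,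
      ← toLpLin_mul_same] using congrArg toEuclideanLin (hC h).eq
  let V : (ι → ℂ) → Submodule ℂ (EuclideanSpace ℂ n) :=
    fun α => ⨅ j, Module.End.eigenspace (toEuclideanLin (Y j)) (α j)
  have hint := LinearMap.IsSymmetric.directSum_isInternal_of_pairwise_commute hS hC'
  have hV := LinearMap.IsSymmetric.orthogonalFamily_iInf_eigenspaces hS
  -- only finitely many of the joint eigenspaces are nonzero
  have hfin : Finite {α // V α ≠ ⊥} :=
    WellFoundedGT.finite_ne_bot_of_iSupIndep hint.submodule_iSupIndep
  have := Fintype.ofFinite {α // V α ≠ ⊥}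
  have hint' := DirectSum.isInternal_ne_bot_iff.2 hint
  have hV' := hV.comp (Subtype.val_injective (p := fun α => V α ≠ ⊥))
  have hn : Module.finrank ℂ (EuclideanSpace ℂ n) = Fintype.card n := by simp
  let g := (Fintype.equivFin n).symm
  refine ⟨(hint'.subordinateOrthonormalBasis hn hV').reindex g, fun i k =>
    (hint'.subordinateOrthonormalBasisIndex hn (g.symm k) hV').1 i, fun i k => ?_⟩
  have := hint'.subordinateOrthonormalBasis_subordinate hn (g.symm k) hV'
  rw [OrthonormalBasis.reindex_apply]
  exact Module.End.mem_eigenspace_iff.1 ((Submodule.mem_iInf _).1 this i)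

lemma eq_sum_ketBra [DecidableEq n]
    {Y : Matrix n n ℂ} (f : OrthonormalBasis n ℂ (EuclideanSpace ℂ n)) {c : n → ℂ}
    (h : ∀ k, toEuclideanLin Y (f k) = c k • f k) : Y = ∑ k, c k • ketBra (f k) := by
  apply toEuclideanLin.injective
  refine f.toBasis.ext fun k => ?_
  have hk : ∀ j, toEuclideanLin (ketBra (f j)) (f k) = if j = k then f j else 0 := by
    intro j
    have := orthonormal_iff_ite.1 f.orthonormal j k
    rw [EuclideanSpace.inner_eq_star_dotProduct] at this
    apply WithLp.ofLp_injective
    rw [ofLp_toLpLin, toLin'_apply, ketBra, vecMulVec_mulVec, dotProduct_comm, this]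
    split_ifs <;> simp
  simp [h, hk, LinearMap.sum_apply]

/-- A classical-quantum state whose conditional operators commute is classical-classical: the
second basis diagonalizes all of them. -/
lemma sum_basis_ketBra_kronecker_mem_CC (e : OrthonormalBasis a ℂ (EuclideanSpace ℂ a))
    {Y : a → Matrix b b ℂ} (hY : ∀ i, (Y i).PosSemidef)
    (hC : Pairwise fun i j => Commute (Y i) (Y j)) (htr : ∑ i, (Y i).trace = 1) :
    ∑ i, ketBra (e i) ⊗ₖ Y i ∈ CC a b := by
  classical
  obtain ⟨f, c, hc⟩ := exists_orthonormalBasis_mulVec (fun i => (hY i).isHermitian) hC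
  have hsum := fun i => eq_sum_ketBra f (hc i)
  have h0 : ∀ i k, 0 ≤ c i k := fun i k => by
    have h := (hY i).dotProduct_mulVec_nonneg (f k).ofLp
    rw [← toLin'_apply, ← ofLp_toLpLin 2 2, hc, dotProduct_comm,
      ← EuclideanSpace.inner_eq_star_dotProduct, inner_smul_right] at h
    simpa [f.orthonormal.1 k] using h
  have hre : ∀ i k, ((c i k).re : ℂ) = c i k := fun i k =>
    (Complex.eq_re_of_ofReal_le (h0 i k)).symm
  refine ⟨e, f, fun i k => (c i k).re, fun i k => (Complex.nonneg_iff.1 (h0 i k)).1, ?_, ?_⟩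
  · have := congrArg Complex.re htr
    rw [Finset.sum_congr rfl fun i _ => congrArg trace (hsum i)] at this
    simpa [trace_sum, trace_smul, trace_ketBra _ (f.orthonormal.1 _)] using this
  · simp only [hre, ← kronecker_sum_smul, ← hsum]

lemma sum_extend_zero {α β M R : Type*} [Fintype α] [Fintype β] [Zero M] [AddCommMonoid R]
    {g : α → β} (hg : Function.Injective g) (Y : α → M) {F : β → M → R} (hF : ∀ i, F i 0 = 0) :
    ∑ i, F i (Function.extend g Y 0 i) = ∑ j, F (g j) (Y j) := by
  refine (Finset.sum_of_injOn g hg.injOn (by simp) (fun i _ hi => ?_) fun j _ => ?_).symm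
  · rw [Function.extend_apply' _ _ _ (by simpa using hi), Pi.zero_apply, hF]
  · rw [hg.extend_apply]

/-- The version of `sum_basis_ketBra_kronecker_mem_CC` for an orthonormal family: complete it to a
basis, and attach the operator `0` to the additional vectors. -/
lemma sum_ketBra_kronecker_mem_CC {J : Type*} [Fintype J] {W : J → EuclideanSpace ℂ a}
    (hW : Orthonormal ℂ W) {Y : J → Matrix b b ℂ} (hY : ∀ j, (Y j).PosSemidef)
    (hC : Pairwise fun i j => Commute (Y i) (Y j)) (htr : ∑ j, (Y j).trace = 1) :
    ∑ j, ketBra (W j) ⊗ₖ Y j ∈ CC a b := by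
  have hcard : Fintype.card J ≤ Fintype.card a := by
    simpa using hW.linearIndependent.fintype_card_le_finrank
  obtain ⟨g⟩ := Function.Embedding.nonempty_of_card_le hcard
  have hg : Function.Injective g := g.injective
  have hv : Orthonormal ℂ ((Set.range g).domRestrict (Function.extend g W 0)) := by
    have : (Set.range g).domRestrict (Function.extend g W 0) =
        W ∘ (Equiv.ofInjective g hg).symm := by
      funext ⟨i, j, hj⟩
      subst hj
      have hj : (Equiv.ofInjective g hg).symm ⟨g j, j, rfl⟩ = j :=
        (Equiv.ofInjective g hg).symm_apply_apply j
      simp only [Set.domRestrict_apply, Function.comp_apply, hg.extend_apply, hj]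
    rw [this]
    exact hW.comp _ (Equiv.injective _)
  obtain ⟨e, he⟩ := hv.exists_orthonormalBasis_extension_of_card_eq (by simp)
  have heg : ∀ j, e (g j) = W j := fun j => by rw [he _ ⟨j, rfl⟩, hg.extend_apply]
  have hZ : ∀ i, (∃ j, g j = i) ∨ Function.extend g Y 0 i = 0 := fun i =>
    (em _).imp id fun h => Function.extend_apply' _ _ _ h
  have := sum_basis_ketBra_kronecker_mem_CC e (Y := Function.extend g Y 0) ?_ ?_ ?_
  · rw [sum_extend_zero hg Y (F := fun i M => ketBra (e i) ⊗ₖ M) (by simp)] at this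
    simpa only [heg] using this
  · intro i
    rcases hZ i with ⟨j, rfl⟩ | h
    · rw [hg.extend_apply]; exact hY j
    · rw [h]; exact PosSemidef.zero
  · intro i i' hne
    rcases hZ i with ⟨j, rfl⟩ | h
    · rcases hZ i' with ⟨j', rfl⟩ | h
      · simp only [hg.extend_apply]
        exact hC fun h => hne (congrArg g h)
      · simp only [h]; exact Commute.zero_right _
    · simp only [h]; exact Commute.zero_left _
  · exact (sum_extend_zero hg Y (F := fun _ M => M.trace) (by simp)).trans htr

/-! ### Relative entropies and balls under compression -/

/-- Data processing for `D_max` under compression by a Hermitian operator. -/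
lemma Dmax_conj_le {K P Q : Matrix n n ℂ} (hK : K.IsHermitian) :
    Dmax (K * P * K) (K * Q * K) ≤ Dmax P Q := by
  refine ENNReal.log_monotone (iInf₂_mono' fun r hr => ⟨r, ?_, le_rfl⟩)
  simpa using mul_mul_mono hK hr

lemma Dmax_anti {k : Type*} {P Q Q' : Matrix k k ℂ} (h : Q ≤ Q') : Dmax P Q' ≤ Dmax P Q := by
  refine ENNReal.log_monotone (iInf₂_mono' fun r hr => ⟨r, hr.trans ?_, le_rfl⟩)
  rw [Matrix.le_iff, ← smul_sub]
  exact (Matrix.le_iff.1 h).smul r.2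

lemma Dfid_anti [DecidableEq n] {P Q Q' : Matrix n n ℂ} (h : Q ≤ Q') : Dfid P Q' ≤ Dfid P Q := by
  refine EReal.neg_le_neg_iff.2 (mul_le_mul_of_nonneg_left (ENNReal.log_monotone
    (ENNReal.ofReal_le_ofReal (fidelity_mono h))) (by norm_num))

lemma Dfid_conj [DecidableEq n] {K P Q : Matrix n n ℂ} (hK : K.IsHermitian) (hP : P.PosSemidef)
    (hQ : Q.PosSemidef) : Dfid (K * P * K) Q = Dfid P (K * Q * K) := by
  rw [Dfid, Dfid, fidelity_conj hK hP hQ]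

/-- Compression by a projection that fixes the state `ρ` maps every ball around `ρ` to itself: it
preserves the fidelity with `ρ` and does not increase the trace. -/
lemma conj_mem_ball [DecidableEq n]
    {K ρ σ : Matrix n n ℂ} {ε : ℝ} (hK : K.IsHermitian) (hKK : K * K = K)
    (hρ : ρ ∈ Density n) (hKρ : K * ρ * K = ρ) (hσ : σ ∈ ball ε ρ) : K * σ * K ∈ ball ε ρ := by
  obtain ⟨⟨hpos, htr⟩, hd⟩ := hσ
  refine ⟨⟨by simpa [hK.eq] using hpos.mul_mul_conjTranspose_same K, le_trans ?_ htr⟩, ?_⟩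
  -- `Tr σ - Tr (K σ K)` is the trace of the complementary compression
  · have h : 0 ≤ (((1 - K) * σ * (1 - K)).trace).re := by
      have := (hpos.mul_mul_conjTranspose_same (1 - K)).trace_nonneg
      rw [conjTranspose_sub, conjTranspose_one, hK.eq] at this
      exact (Complex.nonneg_iff.1 this).1
    have e1 : (K * σ * K).trace = (K * σ).trace := by
      rw [trace_mul_comm, ← Matrix.mul_assoc, hKK]
    have e2 : ((1 - K) * σ * (1 - K)).trace = σ.trace - (K * σ).trace := by
      rw [trace_mul_comm, ← Matrix.mul_assoc]
      simp [sub_mul, mul_sub, hKK]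
    rw [e2, Complex.sub_re] at h
    rw [e1]; linarith
  · have h1 : ρ.trace.re = 1 := by rw [hρ.2]; rfl
    have hf : fidelity ρ (K * σ * K) = fidelity ρ σ := by
      rw [← fidelity_conj hK hρ.1 hpos, hKρ]
    -- the square root in the generalized fidelity vanishes, since `Tr ρ = 1`
    simpa [purifiedDist, genFidelity, h1, hf] using hd

/-! ### Comparison of the correlation measures -/

lemma neg_iSup {ι : Sort*} (f : ι → EReal) : -(⨆ i, f i) = ⨅ i, -f i :=
  EReal.negOrderIso.map_iSup f

lemma neg_iInf {ι : Sort*} (f : ι → EReal) : -(⨅ i, f i) = ⨆ i, -f i :=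
  EReal.negOrderIso.map_iInf f

lemma neg_condEntropy {k : Type*} [DecidableEq k]
    (D : Matrix (k × b) (k × b) ℂ → Matrix (k × b) (k × b) ℂ → EReal)
    (σ : Matrix (k × b) (k × b) ℂ) :
    -condEntropy D σ = ⨅ τ ∈ Density b, D σ ((1 : Matrix k k ℂ) ⊗ₖ τ) := by
  simp only [condEntropy, neg_iSup, neg_neg]

section chain

variable {D : Matrix (a × b) (a × b) ℂ → Matrix (a × b) (a × b) ℂ → EReal}
  (σ : Matrix (a × b) (a × b) ℂ)

lemma neg_condEntropy_le_entanglement [DecidableEq a] (hD : ∀ {Q Q'}, Q ≤ Q' → D σ Q' ≤ D σ Q) :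
    -condEntropy D σ ≤ entanglement D σ := by
  rw [neg_condEntropy]
  refine le_iInf₂ fun τ hτ => ?_
  obtain ⟨ω, hω, h⟩ := exists_density_one_kronecker_ge hτ
  exact (iInf₂_le ω hω).trans (hD h)

lemma entanglement_le_discordCQ : entanglement D σ ≤ discordCQ D σ :=
  biInf_mono CQ_subset_Sep

lemma entanglement_le_discordQC : entanglement D σ ≤ discordQC D σ :=
  biInf_mono QC_subset_Sep

lemma discordCQ_le_discordCC : discordCQ D σ ≤ discordCC D σ :=
  biInf_mono CC_subset_CQ

lemma discordQC_le_discordCC : discordQC D σ ≤ discordCC D σ :=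
  biInf_mono CC_subset_QC

end chain

/-- The equalities hold for every state `ρ` fixed by a projection `K` that maps each `1 ⊗ τ` into
the classical-classical states. -/
lemma smooth_collapse_of_projection [DecidableEq a] [DecidableEq b]
    {ρ K : Matrix (a × b) (a × b) ℂ} {ε : ℝ}
    (hρ : ρ ∈ Density (a × b)) (hK : K.IsHermitian) (hKK : K * K = K) (hKρ : K * ρ * K = ρ)
    (hCC : ∀ τ ∈ Density b, K * ((1 : Matrix a a ℂ) ⊗ₖ τ) * K ∈ CC a b) :
    (-smoothHmin ε ρ
        = smoothInf (entanglement Dmax) ε ρ ∧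
      smoothInf (entanglement Dmax) ε ρ
        = smoothInf (discordCQ Dmax) ε ρ ∧
      smoothInf (discordCQ Dmax) ε ρ
        = smoothInf (discordQC Dmax) ε ρ ∧
      smoothInf (discordQC Dmax) ε ρ
        = smoothInf (discordCC Dmax) ε ρ) ∧
    (-smoothHmax ε ρ
        = smoothSup (entanglement Dfid) ε ρ ∧
      smoothSup (entanglement Dfid) ε ρ
        = smoothSup (discordCQ Dfid) ε ρ ∧
      smoothSup (discordCQ Dfid) ε ρ
        = smoothSup (discordQC Dfid) ε ρ ∧
      smoothSup (discordQC Dfid) ε ρ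
        = smoothSup (discordCC Dfid) ε ρ) := by
  have hball : ∀ σ ∈ ball ε ρ, K * σ * K ∈ ball ε ρ := fun σ hσ =>
    conj_mem_ball hK hKK hρ hKρ hσ
  have hmin : smoothInf (discordCC Dmax) ε ρ ≤ -smoothHmin ε ρ := by
    simp only [smoothHmin, smoothSup, neg_iSup, neg_condEntropy]
    refine le_iInf₂ fun σ hσ => le_iInf₂ fun τ hτ => ?_
    -- compare `σ` and `1 ⊗ τ` with `K σ K` and the state `K (1 ⊗ τ) K`
    exact (iInf₂_le _ (hball σ hσ)).trans ((iInf₂_le _ (hCC τ hτ)).trans (Dmax_conj_le hK))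
  have hmax : smoothSup (discordCC Dfid) ε ρ ≤ -smoothHmax ε ρ := by
    simp only [smoothHmax, smoothInf, neg_iInf, neg_condEntropy]
    refine iSup₂_le fun σ hσ => le_iSup₂_of_le _ (hball σ hσ) (le_iInf₂ fun τ hτ => ?_)
    -- here `K` acts on `σ` only, and moves over to `1 ⊗ τ`
    rw [Dfid_conj hK hσ.1.1 (PosSemidef.one.kronecker hτ.1)]
    exact iInf₂_le _ (hCC τ hτ)
  have m1 : -smoothHmin ε ρ ≤ smoothInf (entanglement Dmax) ε ρ := by
    simp only [smoothHmin, smoothSup, neg_iSup]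
    exact iInf₂_mono fun σ _ => neg_condEntropy_le_entanglement σ Dmax_anti
  have m2 : smoothInf (entanglement Dmax) ε ρ ≤ smoothInf (discordCQ Dmax) ε ρ :=
    iInf₂_mono fun σ _ => entanglement_le_discordCQ σ
  have m3 : smoothInf (entanglement Dmax) ε ρ ≤ smoothInf (discordQC Dmax) ε ρ :=
    iInf₂_mono fun σ _ => entanglement_le_discordQC σ
  have m4 : smoothInf (discordCQ Dmax) ε ρ ≤ smoothInf (discordCC Dmax) ε ρ :=
    iInf₂_mono fun σ _ => discordCQ_le_discordCC σ
  have m5 : smoothInf (discordQC Dmax) ε ρ ≤ smoothInf (discordCC Dmax) ε ρ :=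
    iInf₂_mono fun σ _ => discordQC_le_discordCC σ
  have f1 : -smoothHmax ε ρ ≤ smoothSup (entanglement Dfid) ε ρ := by
    simp only [smoothHmax, smoothInf, neg_iInf]
    exact iSup₂_mono fun σ _ => neg_condEntropy_le_entanglement σ Dfid_anti
  have f2 : smoothSup (entanglement Dfid) ε ρ ≤ smoothSup (discordCQ Dfid) ε ρ :=
    iSup₂_mono fun σ _ => entanglement_le_discordCQ σ
  have f3 : smoothSup (entanglement Dfid) ε ρ ≤ smoothSup (discordQC Dfid) ε ρ :=
    iSup₂_mono fun σ _ => entanglement_le_discordQC σ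
  have f4 : smoothSup (discordCQ Dfid) ε ρ ≤ smoothSup (discordCC Dfid) ε ρ :=
    iSup₂_mono fun σ _ => discordCQ_le_discordCC σ
  have f5 : smoothSup (discordQC Dfid) ε ρ ≤ smoothSup (discordCC Dfid) ε ρ :=
    iSup₂_mono fun σ _ => discordQC_le_discordCC σ
  refine ⟨⟨?_, ?_, ?_, ?_⟩, ?_, ?_, ?_, ?_⟩ <;> order

/-! ### Premeasurement states -/

section premeasurement

variable {J : Type*} [Fintype J] {W : J → EuclideanSpace ℂ a} {X : J → Matrix b b ℂ}

/-- The projection onto the range of `V_X`. The off-diagonal terms `|W j⟩⟨W k| ⊗ X j X k` vanish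
since the `X j` are mutually orthogonal. -/
lemma premeasurementIsometry_mul_conjTranspose [DecidableEq b] (hX : IsPVM X) :
    premeasurementIsometry W X * (premeasurementIsometry W X)ᴴ = ∑ j, ketBra (W j) ⊗ₖ X j := by
  classical
  have hXX : ∀ j k s t, ∑ r, X j s r * star (X k t r) = if j = k then X j s t else 0 := by
    intro j k s t
    have : ∑ r, X j s r * star (X k t r) = (X j * X k) s t := by
      rw [Matrix.mul_apply]
      exact Finset.sum_congr rfl fun r _ => by rw [(hX.isHermitian k).apply]
    rw [this]
    split_ifs with h
    · rw [← h, hX.idem]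
    · rw [hX.orthogonal _ _ h]; rfl
  ext ⟨i, s⟩ ⟨i', t⟩
  simp only [premeasurementIsometry, Matrix.mul_apply, conjTranspose_apply, Matrix.of_apply,
    Matrix.sum_apply, kroneckerMap_apply, ketBra, vecMulVec_apply, Pi.star_apply, star_sum,
    star_mul', Finset.sum_mul_sum]
  rw [Finset.sum_comm]
  refine Finset.sum_congr rfl fun j _ => ?_
  rw [Finset.sum_comm]
  have : ∀ k r, W j i * X j s r * (star (W k i') * star (X k t r)) =
      (W j i * star (W k i')) * (X j s r * star (X k t r)) := fun k r => by ring
  simp only [this, ← Finset.mul_sum, hXX]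
  simp

lemma premeasurementIsometry_conjTranspose_mul [DecidableEq b]
    (hW : Orthonormal ℂ W) (hX : IsPVM X) :
    (premeasurementIsometry W X)ᴴ * premeasurementIsometry W X = 1 := by
  classical
  have hWW : ∀ j k, ∑ i, star (W j i) * W k i = if j = k then 1 else 0 := by
    intro j k
    rw [← orthonormal_iff_ite.1 hW j k, EuclideanSpace.inner_eq_star_dotProduct]
    exact Finset.sum_congr rfl fun i _ => mul_comm _ _
  have key : ∑ j, X j * X j = 1 := by simp only [hX.idem, hX.sum_eq_one]
  rw [← key]
  ext s t
  simp only [premeasurementIsometry, Matrix.mul_apply, conjTranspose_apply, Matrix.of_apply,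
    Matrix.sum_apply, star_sum, star_mul', Finset.sum_mul_sum, Fintype.sum_prod_type]
  have : ∀ i r j k, star (W j i) * star (X j r s) * (W k i * X k r t) =
      (star (W j i) * W k i) * (X j s r * X k r t) := fun i r j k => by
    rw [(hX.isHermitian j).apply]; ring
  simp only [this]
  calc _ = ∑ j, ∑ k, ∑ r, (∑ i, star (W j i) * W k i) * (X j s r * X k r t) := by
        simp only [Finset.sum_mul]
        rw [Finset.sum_congr rfl fun i _ => Finset.sum_comm, Finset.sum_comm]
        refine Finset.sum_congr rfl fun j _ => ?_
        rw [Finset.sum_congr rfl fun i _ => Finset.sum_comm, Finset.sum_comm]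
        refine Finset.sum_congr rfl fun k _ => ?_
        rw [Finset.sum_comm]
    _ = _ := by
        simp only [hWW]
        simp

lemma ketBra_mul_ketBra (v w : EuclideanSpace ℂ a) :
    ketBra v * ketBra w = inner ℂ v w • vecMulVec v.ofLp (star w.ofLp) := by
  rw [ketBra, ketBra, vecMulVec_mul_vecMulVec, EuclideanSpace.inner_eq_star_dotProduct,
    dotProduct_comm, vecMulVec_smul]

/-- The projection onto the range of `V_X` turns `1 ⊗ τ` into the classical-classical state
`∑ j, |W j⟩⟨W j| ⊗ X j τ X j`. -/
lemma conj_one_kronecker_mem_CC [DecidableEq a] [DecidableEq b]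
    (hW : Orthonormal ℂ W) (hX : IsPVM X) {τ : Matrix b b ℂ}
    (hτ : τ ∈ Density b) :
    (∑ j, ketBra (W j) ⊗ₖ X j) * ((1 : Matrix a a ℂ) ⊗ₖ τ) * (∑ j, ketBra (W j) ⊗ₖ X j) ∈
      CC a b := by
  classical
  have h : (∑ j, ketBra (W j) ⊗ₖ X j) * ((1 : Matrix a a ℂ) ⊗ₖ τ) * (∑ j, ketBra (W j) ⊗ₖ X j) =
      ∑ j, ketBra (W j) ⊗ₖ (X j * τ * X j) := by
    simp only [Matrix.sum_mul, Matrix.mul_sum, ← mul_kronecker_mul, ketBra_mul_ketBra,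
      orthonormal_iff_ite.1 hW, mul_one]
    refine Finset.sum_congr rfl fun j _ => ?_
    rw [Finset.sum_eq_single j (fun k _ hkj => by simp [hkj]) (by simp)]
    simp [ketBra]
  rw [h]
  refine sum_ketBra_kronecker_mem_CC hW (fun j => ?_) (fun i j hij => ?_) ?_
  · simpa [(hX.isHermitian j).eq] using hτ.1.mul_mul_conjTranspose_same (X j)
  · have h0 : ∀ {i j}, i ≠ j → X i * τ * X i * (X j * τ * X j) = 0 := fun {i j} hij => by
      rw [show X i * τ * X i * (X j * τ * X j) = X i * τ * (X i * X j) * (τ * X j) by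
        simp only [Matrix.mul_assoc], hX.orthogonal i j hij]
      simp
    exact (h0 hij).trans (h0 hij.symm).symm
  · rw [← hτ.2]
    conv_rhs => rw [← Matrix.one_mul τ, ← hX.sum_eq_one, Matrix.sum_mul, trace_sum]
    refine Finset.sum_congr rfl fun j _ => ?_
    rw [trace_mul_comm, ← Matrix.mul_assoc, hX.idem]

end premeasurement

end SmoothCollapse

end

theorem theorem6 {M S J : Type*} [Fintype M] [DecidableEq M] [Fintype S] [DecidableEq S]
    [Fintype J]
    (W : J → EuclideanSpace ℂ M) (hW : Orthonormal ℂ W)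
    (X : J → Matrix S S ℂ) (hX : SmoothCollapse.IsPVM X)
    (ρS : Matrix S S ℂ) (hρS : ρS ∈ SmoothCollapse.Density S)
    (ρ : Matrix (M × S) (M × S) ℂ) (hρ : ρ = SmoothCollapse.premeasurementState W X ρS)
    (ε : ℝ) (hε : 0 ≤ ε) :
    (-SmoothCollapse.smoothHmin ε ρ
        = SmoothCollapse.smoothInf (SmoothCollapse.entanglement SmoothCollapse.Dmax) ε ρ ∧
      SmoothCollapse.smoothInf (SmoothCollapse.entanglement SmoothCollapse.Dmax) ε ρ
        = SmoothCollapse.smoothInf (SmoothCollapse.discordCQ SmoothCollapse.Dmax) ε ρ ∧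
      SmoothCollapse.smoothInf (SmoothCollapse.discordCQ SmoothCollapse.Dmax) ε ρ
        = SmoothCollapse.smoothInf (SmoothCollapse.discordQC SmoothCollapse.Dmax) ε ρ ∧
      SmoothCollapse.smoothInf (SmoothCollapse.discordQC SmoothCollapse.Dmax) ε ρ
        = SmoothCollapse.smoothInf (SmoothCollapse.discordCC SmoothCollapse.Dmax) ε ρ) ∧
    (-SmoothCollapse.smoothHmax ε ρ
        = SmoothCollapse.smoothSup (SmoothCollapse.entanglement SmoothCollapse.Dfid) ε ρ ∧
      SmoothCollapse.smoothSup (SmoothCollapse.entanglement SmoothCollapse.Dfid) ε ρ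
        = SmoothCollapse.smoothSup (SmoothCollapse.discordCQ SmoothCollapse.Dfid) ε ρ ∧
      SmoothCollapse.smoothSup (SmoothCollapse.discordCQ SmoothCollapse.Dfid) ε ρ
        = SmoothCollapse.smoothSup (SmoothCollapse.discordQC SmoothCollapse.Dfid) ε ρ ∧
      SmoothCollapse.smoothSup (SmoothCollapse.discordQC SmoothCollapse.Dfid) ε ρ
        = SmoothCollapse.smoothSup (SmoothCollapse.discordCC SmoothCollapse.Dfid) ε ρ) := by
  have hK := SmoothCollapse.premeasurementIsometry_mul_conjTranspose (W := W) hX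
  have hV := SmoothCollapse.premeasurementIsometry_conjTranspose_mul hW hX
  rw [SmoothCollapse.premeasurementState] at hρ
  set V := SmoothCollapse.premeasurementIsometry W X
  refine SmoothCollapse.smooth_collapse_of_projection (K := V * V.conjTranspose) ?_
    (Matrix.isHermitian_mul_conjTranspose_self V) ?_ ?_ fun τ hτ => ?_
  · rw [hρ]
    refine ⟨hρS.1.mul_mul_conjTranspose_same V, ?_⟩
    rw [Matrix.trace_mul_comm, ← Matrix.mul_assoc, hV, Matrix.one_mul, hρS.2]
  · rw [Matrix.mul_assoc, ← Matrix.mul_assoc V.conjTranspose, hV, Matrix.one_mul]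
  · calc _ = V * (V.conjTranspose * V) * ρS * (V.conjTranspose * V) * V.conjTranspose := by
          rw [hρ]; simp only [Matrix.mul_assoc]
      _ = ρ := by rw [hV, hρ]; simp only [Matrix.mul_one]
  · rw [hK]
    exact SmoothCollapse.conj_one_kronecker_mem_CC hW hX hτ
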